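/- Consider a ring of $N\ge 1$ processors, numbered cyclically modulo $N$, each of which holds at most one token. Herman's algorithm proceeds in discrete time: at every step, simultaneously, each processor holding a token either keeps it or passes it to the next processor in the ring, each with probability $\tfrac12$, independently of the other processors and of the earlier steps; if a processor keeps its token and also receives one from the previous processor, the two tokens annihilate each other. The time to stabilisation is the first time $T\in\{0,1,2,\dots\}\cup\{\infty\}$ at which exactly one token is left. Then, for every start configuration with an odd number of tokens, \[ \mathbb{E}(T) < \frac{(\pi^2-8)\,N^2}{12}. \] -/

import Mathlib

open MeasureTheory
open scoped ENNReal

/-- One synchronous step of Herman's algorithm on the ring of processors `Fin N` (addition is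
modulo `N`). `A` is the set of processors that hold a token; `c i = true` means that processor `i`
passes its token (if it has one) to the next processor `i + 1`, and `c i = false` that it keeps it.
A processor that both keeps a token and receives one ends up without a token, hence the
symmetric difference of the kept and of the passed tokens. -/
def hermanStep {N : ℕ} [NeZero N] (c : Fin N → Bool) (A : Finset (Fin N)) : Finset (Fin N) :=
  symmDiff (A.filter fun i => c i = false) ((A.filter fun i => c i = true).image fun i => i + 1)

/-- The configuration after `t` steps from the start configuration `A`, where `ω t i` is the coin
of processor `i` at time `t`. -/
def hermanRun {N : ℕ} [NeZero N] (A : Finset (Fin N)) (ω : ℕ → Fin N → Bool) :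
    ℕ → Finset (Fin N)
  | 0 => A
  | t + 1 => hermanStep (ω t) (hermanRun A ω t)

/-- The time to stabilisation: the first time at which exactly one token is left
(`⊤` if this never happens). -/
noncomputable def stabilisationTime {N : ℕ} [NeZero N] (A : Finset (Fin N))
    (ω : ℕ → Fin N → Bool) : ℕ∞ :=
  ⨅ (t : ℕ) (_ : (hermanRun A ω t).card = 1), (t : ℕ∞)

/-- The law of all the coins: independent over times and processors, each coin being fair. -/
noncomputable def hermanCoins (N : ℕ) : Measure (ℕ → Fin N → Bool) :=
  Measure.infinitePi fun _ : ℕ => Measure.pi fun _ : Fin N => (PMF.uniformOfFintype Bool).toMeasure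

/-- The expected time to stabilisation from the start configuration `A`, in `[0, ∞]`. -/
noncomputable def expectedStabilisationTime {N : ℕ} [NeZero N] (A : Finset (Fin N)) : ℝ≥0∞ :=
  ∫⁻ ω, (stabilisationTime A ω : ℝ≥0∞) ∂(hermanCoins N)

/-! Attach to each processor the sign of the parity of the number of tokens met so far on a walk
around the ring. As the number of tokens is odd, this sign sequence `s` is antiperiodic with period
`N`. Up to a global sign, a step replaces `s (j + 1)` by `s j` or keeps it, by the coin of
processor `j`. The `N` signs in a window thus become independent, with known means and variances,
and the energy, the sum of the squared window sums `H j`, grows in the mean by exactly `N` times the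
number of excess tokens. The deficit of the energy with respect to a single token, divided by
`2 * N`, therefore falls in the mean by `k` in a step from `2 * k + 1` tokens.

This deficit is at most `N ^ 2 / 6 * (1 - 1 / (2 * k + 1) ^ 2)`. Indeed, let `P` be a bounded odd
function whose derivative at `h` is at most `h ^ 2 - a ^ 2`. Since `H j - H (j + 1) = 2 * s j`, the
mean of the derivative between `H j` and `H (j + 1)` is `s j * (P (H j) - P (H (j + 1))) / 2`. In
the sum over `j` these terms contribute, after summation by parts, only at the `2 * k + 1` sign
changes of `s`, which bounds `∑ H j ^ 2` from below; `a = N / (2 * k + 1)` is the optimal choice.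

The deficit bounds tell which part of the fall of the deficit can take place at which speed. Adding
up the times spent at the speeds `i + 1` yields partial sums of a multiple of
`∑ 1 / ((2 * i + 1) ^ 2 * (2 * i + 3) ^ 2) = (π ^ 2 - 8) / 16`. The time potential obtained in this
way falls in the mean by at least `1` in each step before stabilisation, and hence it dominates the
expected time to stabilisation.
-/

section SignSequence

variable {N : ℕ} {s : ℕ → ℝ}

theorem sum_range_add_of_periodic {M : Type*} [AddCommGroup M] {f : ℕ → M}
    (hf : Function.Periodic f N) (p : ℕ) :
    ∑ j ∈ Finset.range N, f (j + p) = ∑ j ∈ Finset.range N, f j := by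
  induction p with
  | zero => rfl
  | succ p ih =>
    have hends := Finset.sum_range_succ' (fun j => f (j + p)) N
    rw [Finset.sum_range_succ, zero_add, add_comm N p, hf p] at hends
    simpa only [add_assoc, add_comm 1] using (add_right_cancel hends).symm.trans ih

/-- The sum of `s` over the window of length `N` that starts at `j`. -/
def windowSum (N : ℕ) (s : ℕ → ℝ) (j : ℕ) : ℝ := ∑ d ∈ Finset.range N, s (j + d)

/-- The sum of the squares of `N` consecutive window sums, the quantity whose mean change in one
step of Herman's algorithm is known exactly. -/
def windowEnergy (N : ℕ) (s : ℕ → ℝ) : ℝ := ∑ j ∈ Finset.range N, windowSum N s j ^ 2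

theorem windowEnergy_const_mul (N : ℕ) (s : ℕ → ℝ) (u : ℝ) :
    windowEnergy N (fun j => u * s j) = u ^ 2 * windowEnergy N s := by
  simp only [windowEnergy, windowSum, ← Finset.mul_sum, mul_pow]

theorem windowSum_succ (hs : Function.Antiperiodic s N) (j : ℕ) :
    windowSum N s (j + 1) = windowSum N s j - 2 * s j := by
  have hends := Finset.sum_range_succ' (fun d => s (j + d)) N
  rw [Finset.sum_range_succ, hs, add_zero] at hends
  simp only [windowSum, add_assoc, add_comm 1]
  linarith

theorem antiperiodic_windowSum (hs : Function.Antiperiodic s N) :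
    Function.Antiperiodic (windowSum N s) N := fun j => by
  simp only [windowSum, add_right_comm j N, hs _, Finset.sum_neg_distrib]

theorem sum_sq_windowSum_add (hs : Function.Antiperiodic s N) (p : ℕ) :
    ∑ j ∈ Finset.range N, windowSum N s (j + p) ^ 2 = windowEnergy N s :=
  sum_range_add_of_periodic (f := fun j => windowSum N s j ^ 2)
    (fun j => by simp only [antiperiodic_windowSum hs j, neg_sq]) p

theorem windowEnergy_add_right (hs : Function.Antiperiodic s N) (p : ℕ) :
    windowEnergy N (fun j => s (j + p)) = windowEnergy N s := by
  rw [← sum_sq_windowSum_add hs p]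
  simp only [windowEnergy, windowSum, add_right_comm]

theorem sum_sq_add_sq_windowSum_succ (hs : Function.Antiperiodic s N) :
    ∑ j ∈ Finset.range N, (windowSum N s j ^ 2 + windowSum N s (j + 1) ^ 2)
      = 2 * windowEnergy N s := by
  rw [Finset.sum_add_distrib, sum_sq_windowSum_add hs 1, two_mul, windowEnergy]

theorem sum_sq_mean_windowSum (hs : Function.Antiperiodic s N) (hsign : ∀ j, s j ^ 2 = 1) :
    ∑ j ∈ Finset.range N, ((windowSum N s j + windowSum N s (j + 1)) / 2) ^ 2
      = windowEnergy N s - N := by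
  have hedge (j : ℕ) : ((windowSum N s j + windowSum N s (j + 1)) / 2) ^ 2
      = (windowSum N s j ^ 2 + windowSum N s (j + 1) ^ 2) / 2 - 1 := by
    rw [windowSum_succ hs]
    linear_combination -hsign j
  simp only [hedge, Finset.sum_sub_distrib, ← Finset.sum_div, sum_sq_add_sq_windowSum_succ hs,
    Finset.sum_const, Finset.card_range, nsmul_eq_mul, mul_one]
  ring

theorem sum_range_sq_sub_two_mul (x : ℝ) (n : ℕ) :
    ∑ i ∈ Finset.range n, (x - 2 * i) ^ 2
      = n * x ^ 2 - 2 * x * (n * (n - 1)) + 2 * (n * (n - 1) * (2 * n - 1)) / 3 := by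
  induction n with
  | zero => simp
  | succ n ih => rw [Finset.sum_range_succ, ih]; push_cast; ring

theorem windowEnergy_of_const (hs : Function.Antiperiodic s N) {u : ℝ} {p : ℕ}
    (hp : ∀ i < N, s (p + i) = u) :
    windowEnergy N s = u ^ 2 * (N * (N ^ 2 + 2) / 3) := by
  have hwindow : ∀ i ≤ N, windowSum N s (p + i) = u * (N - 2 * i) := by
    intro i hi
    induction i with
    | zero =>
      rw [add_zero, windowSum, Finset.sum_congr rfl fun d hd => hp d (Finset.mem_range.1 hd)]
      simp [mul_comm]
    | succ i ih =>
      rw [← add_assoc, windowSum_succ hs, ih (by omega), hp i (by omega)]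
      push_cast
      ring
  calc windowEnergy N s = ∑ i ∈ Finset.range N, (u * ((N : ℝ) - 2 * i)) ^ 2 := by
        rw [← sum_sq_windowSum_add hs p]
        exact Finset.sum_congr rfl fun i hi => by
          rw [add_comm, hwindow i (Finset.mem_range.1 hi).le]
    _ = u ^ 2 * (N * (N ^ 2 + 2) / 3) := by
        simp only [mul_pow, ← Finset.mul_sum, sum_range_sq_sub_two_mul]
        ring

/-- The primitive of `min (h ^ 2 - a ^ 2) 0` that vanishes at `0`: the cubic `h ^ 3 / 3 - a ^ 2 * h`
on `[-a, a]`, continued by constants. It is the test function in the lower bound for the window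
energy. -/
noncomputable def clampedCubic (a h : ℝ) : ℝ :=
  max (-a) (min a h) ^ 3 / 3 - a ^ 2 * max (-a) (min a h)

theorem abs_clampedCubic_le {a : ℝ} (ha : 0 ≤ a) (h : ℝ) :
    |clampedCubic a h| ≤ 2 * a ^ 3 / 3 := by
  have hlower : -a ≤ max (-a) (min a h) := le_max_left _ _
  have hupper : max (-a) (min a h) ≤ a := max_le (by linarith) (min_le_left _ _)
  unfold clampedCubic
  generalize max (-a) (min a h) = c at hlower hupper
  rw [abs_le]
  constructor
  · nlinarith [mul_nonneg (sq_nonneg (c - a)) (by linarith : 0 ≤ c + 2 * a)]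
  · nlinarith [mul_nonneg (sq_nonneg (c + a)) (by linarith : 0 ≤ 2 * a - c)]

theorem odd_clampedCubic {a : ℝ} (ha : 0 ≤ a) : Function.Odd (clampedCubic a) := fun h => by
  have hclamp : max (-a) (min a (-h)) = -max (-a) (min a h) := by
    rw [← min_neg_neg, neg_neg, ← max_neg_neg, max_min_distrib_left, max_eq_right (by linarith)]
  rw [clampedCubic, clampedCubic, hclamp]
  ring

theorem clampedCubic_sub_le {a x y : ℝ} (ha : 0 ≤ a) (hxy : x ≤ y) :
    clampedCubic a y - clampedCubic a x ≤ (y ^ 3 / 3 - a ^ 2 * y) - (x ^ 3 / 3 - a ^ 2 * x) := by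
  set F : ℝ → ℝ := fun h => h ^ 3 / 3 - a ^ 2 * h with hF
  have hsplit (h : ℝ) : F h = F (min h (-a)) + clampedCubic a h + F (max h a) := by
    rcases le_total h (-a) with hle | hge
    · simp only [hF, clampedCubic, min_eq_left hle, min_eq_right (by linarith : h ≤ a),
        max_eq_left hle, max_eq_right (by linarith : h ≤ a)]
      ring
    rcases le_total h a with hle | hge'
    · simp only [hF, clampedCubic, min_eq_right hge, min_eq_right hle, max_eq_right hge,
        max_eq_right hle]
      ring
    · simp only [hF, clampedCubic, min_eq_right hge, min_eq_left hge',
        max_eq_right (by linarith : -a ≤ a), max_eq_left hge']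
      ring
  have hF_le {v w : ℝ} (hvw : v ≤ w) (hv : a ^ 2 ≤ v ^ 2) (hmid : a ^ 2 ≤ v * w)
      (hw : a ^ 2 ≤ w ^ 2) : F v ≤ F w := by
    simp only [hF]
    nlinarith [mul_nonneg (sub_nonneg.2 hvw) (by linarith : 0 ≤ v ^ 2 + v * w + w ^ 2 - 3 * a ^ 2)]
  have hlower : F (min x (-a)) ≤ F (min y (-a)) := by
    have hx := min_le_right x (-a)
    have hy := min_le_right y (-a)
    exact hF_le (min_le_min_right _ hxy) (by nlinarith) (by nlinarith) (by nlinarith)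
  have hupper : F (max x a) ≤ F (max y a) := by
    have hx := le_max_right x a
    have hy := le_max_right y a
    exact hF_le (max_le_max_right _ hxy) (by nlinarith) (by nlinarith) (by nlinarith)
  have hx := hsplit x
  have hy := hsplit y
  simp only [hF] at hx hy hlower hupper
  linarith

theorem sub_clampedCubic_windowSum_le {a : ℝ} (ha : 0 ≤ a) (hs : Function.Antiperiodic s N)
    {j : ℕ} (hsign : s j ^ 2 = 1) :
    s j * (clampedCubic a (windowSum N s j) - clampedCubic a (windowSum N s (j + 1))) / 2
      ≤ (windowSum N s j ^ 2 + windowSum N s (j + 1) ^ 2) / 2 - 2 / 3 - a ^ 2 := by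
  have hsucc := windowSum_succ hs j
  rcases sq_eq_one_iff.1 hsign with h | h <;> rw [h] at hsucc ⊢
  · have hle := clampedCubic_sub_le ha (x := windowSum N s (j + 1)) (y := windowSum N s j)
      (by linarith)
    rw [hsucc] at hle ⊢
    linarith
  · have hle := clampedCubic_sub_le ha (x := windowSum N s j) (y := windowSum N s (j + 1))
      (by linarith)
    rw [hsucc] at hle ⊢
    linarith

theorem neg_mul_le_sum_clampedCubic {a : ℝ} (ha : 0 ≤ a) (hs : Function.Antiperiodic s N) :
    -(2 * a ^ 3 / 3 * ∑ j ∈ Finset.range N, |s (j + 1) - s j|)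
      ≤ ∑ j ∈ Finset.range N,
        s j * (clampedCubic a (windowSum N s j) - clampedCubic a (windowSum N s (j + 1))) := by
  set P : ℕ → ℝ := fun j => clampedCubic a (windowSum N s j) with hP
  have hshift : ∑ j ∈ Finset.range N, s (j + 1) * P (j + 1) = ∑ j ∈ Finset.range N, s j * P j :=
    sum_range_add_of_periodic (f := fun j => s j * P j) (fun j => by
      simp only [hP, antiperiodic_windowSum hs j, hs j, odd_clampedCubic ha _, neg_mul_neg]) 1
  have hparts : ∑ j ∈ Finset.range N, s j * (P j - P (j + 1))
      = ∑ j ∈ Finset.range N, (s (j + 1) - s j) * P (j + 1) := by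
    simp only [mul_sub, sub_mul, Finset.sum_sub_distrib, hshift]
  rw [hparts, Finset.mul_sum, ← Finset.sum_neg_distrib]
  gcongr with j
  rw [neg_le_iff_add_nonneg']
  have := neg_le_of_abs_le ((abs_mul _ _).trans_le <| mul_le_mul_of_nonneg_left
    (abs_clampedCubic_le ha (windowSum N s (j + 1))) (abs_nonneg (s (j + 1) - s j)))
  linarith

theorem le_windowEnergy {a : ℝ} (ha : 0 ≤ a) (hs : Function.Antiperiodic s N)
    (hsign : ∀ j, s j ^ 2 = 1) :
    N * (a ^ 2 + 2 / 3) - a ^ 3 / 3 * ∑ j ∈ Finset.range N, |s (j + 1) - s j|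
      ≤ windowEnergy N s := by
  have hedges := Finset.sum_le_sum fun j (_ : j ∈ Finset.range N) =>
    sub_clampedCubic_windowSum_le ha hs (hsign j)
  have hparts := neg_mul_le_sum_clampedCubic ha hs
  simp only [Finset.sum_sub_distrib, ← Finset.sum_div, sum_sq_add_sq_windowSum_succ hs,
    Finset.sum_const, Finset.card_range, nsmul_eq_mul] at hedges
  linarith

end SignSequence

section Configuration

variable {N : ℕ} {A : Finset (Fin N)}

/-- The sign of a processor: `-1` if it holds a token, `1` otherwise. -/
def tokenSign (A : Finset (Fin N)) (i : Fin N) : ℝ := if i ∈ A then -1 else 1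

theorem tokenSign_sq (A : Finset (Fin N)) (i : Fin N) : tokenSign A i ^ 2 = 1 := by
  unfold tokenSign; split_ifs <;> norm_num

variable [NeZero N]

theorem injOn_ofNat_add (j : ℕ) :
    Set.InjOn (fun d => Fin.ofNat N (j + d)) (Finset.range N) := by
  intro d hd e he hde
  have hmod : j + d ≡ j + e [MOD N] := congrArg Fin.val hde
  exact (Nat.ModEq.add_left_cancel' j hmod).eq_of_lt_of_lt
    (Finset.mem_range.1 hd) (Finset.mem_range.1 he)

@[to_additive]
theorem prod_range_ofNat_add {M : Type*} [CommMonoid M] (f : Fin N → M) (j : ℕ) :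
    ∏ d ∈ Finset.range N, f (Fin.ofNat N (j + d)) = ∏ i, f i := by
  have hadd (d : Fin N) : Fin.ofNat N (j + d) = Fin.ofNat N j + d := by
    ext; simp [Fin.val_add]
  rw [Finset.prod_range, ← Equiv.prod_comp (Equiv.addLeft (Fin.ofNat N j)) f]
  simp only [hadd, Equiv.coe_addLeft]

/-- The sign of the parity of the number of tokens met on the way from processor `0` to
processor `j - 1`, going around the ring as often as necessary. -/
def paritySign (A : Finset (Fin N)) (j : ℕ) : ℝ :=
  ∏ i ∈ Finset.range j, tokenSign A (Fin.ofNat N i)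

theorem paritySign_sq (A : Finset (Fin N)) (j : ℕ) : paritySign A j ^ 2 = 1 := by
  rw [paritySign, ← Finset.prod_pow]
  exact Finset.prod_eq_one fun i _ => tokenSign_sq A _

theorem paritySign_succ (A : Finset (Fin N)) (j : ℕ) :
    paritySign A (j + 1) = paritySign A j * tokenSign A (Fin.ofNat N j) :=
  Finset.prod_range_succ _ _

theorem paritySign_self (A : Finset (Fin N)) : paritySign A N = (-1) ^ A.card := by
  calc paritySign A N = ∏ i, tokenSign A i := by
        simpa only [paritySign, zero_add] using prod_range_ofNat_add (tokenSign A) 0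
    _ = (-1) ^ A.card := by simp [tokenSign]

theorem antiperiodic_paritySign (hA : Odd A.card) : Function.Antiperiodic (paritySign A) N := by
  intro j
  induction j with
  | zero => rw [zero_add, paritySign_self, hA.neg_one_pow, paritySign, Finset.prod_range_zero]
  | succ j ih =>
    have hmod : Fin.ofNat N (j + N) = Fin.ofNat N j := by ext; simp
    rw [add_right_comm, paritySign_succ, ih, paritySign_succ, hmod, neg_mul]

theorem paritySign_succ_sub (A : Finset (Fin N)) (j : ℕ) :
    paritySign A (j + 1) - paritySign A j
      = if Fin.ofNat N j ∈ A then -2 * paritySign A j else 0 := by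
  rw [paritySign_succ, tokenSign]
  split_ifs <;> ring

theorem sum_paritySign_succ_sub_sq (A : Finset (Fin N)) (j : ℕ) :
    ∑ d ∈ Finset.range N, (paritySign A (j + d + 1) - paritySign A (j + d)) ^ 2
      = 4 * A.card := by
  have hterm (n : ℕ) : (paritySign A (n + 1) - paritySign A n) ^ 2
      = if Fin.ofNat N n ∈ A then 4 else 0 := by
    rw [paritySign_succ_sub, ite_pow, mul_pow, paritySign_sq]
    norm_num
  simp only [hterm]
  rw [sum_range_ofNat_add fun i => if i ∈ A then (4 : ℝ) else 0]
  simp [mul_comm]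

theorem sum_abs_paritySign_succ_sub (A : Finset (Fin N)) :
    ∑ j ∈ Finset.range N, |paritySign A (j + 1) - paritySign A j| = 2 * A.card := by
  have hterm (j : ℕ) : |paritySign A (j + 1) - paritySign A j|
      = (paritySign A (0 + j + 1) - paritySign A (0 + j)) ^ 2 / 2 := by
    rw [zero_add, paritySign_succ_sub]
    rcases sq_eq_one_iff.1 (paritySign_sq A j) with h | h <;> split_ifs <;> norm_num [h]
  simp only [hterm]
  rw [← Finset.sum_div, sum_paritySign_succ_sub_sq]
  ring

theorem windowEnergy_paritySign_of_card_eq_one (hA : A.card = 1) :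
    windowEnergy N (paritySign A) = N * (N ^ 2 + 2) / 3 := by
  obtain ⟨p, rfl⟩ := Finset.card_eq_one.1 hA
  have hconst : ∀ i < N, paritySign {p} (p + 1 + i) = paritySign {p} (p + 1) := by
    intro i hi
    induction i with
    | zero => rfl
    | succ i ih =>
      have hne := (injOn_ofNat_add (N := N) p).ne (x := 1 + i) (y := 0)
        (by simpa [add_comm] using hi) (by simpa using NeZero.pos N) (by omega)
      simp only [add_zero, Fin.ofNat_eq_cast, Fin.cast_val_eq_self] at hne
      rw [← add_assoc, paritySign_succ, ih (by omega), tokenSign, add_assoc,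
        Fin.ofNat_eq_cast, if_neg (Finset.notMem_singleton.2 hne), mul_one]
  rw [windowEnergy_of_const (antiperiodic_paritySign (by simp)) hconst, paritySign_sq, one_mul]

theorem succ_mem_hermanStep (c : Fin N → Bool) (A : Finset (Fin N)) (i : Fin N) :
    i + 1 ∈ hermanStep c A ↔ Xor (i + 1 ∈ A ∧ c (i + 1) = false) (i ∈ A ∧ c i = true) := by
  simp [hermanStep, Finset.mem_symmDiff, Xor]

theorem tokenSign_hermanStep (c : Fin N → Bool) (A : Finset (Fin N)) (i : Fin N) :
    tokenSign (hermanStep c A) (i + 1)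
      = (if c (i + 1) then 1 else tokenSign A (i + 1)) * (if c i then tokenSign A i else 1) := by
  simp only [tokenSign, succ_mem_hermanStep]
  by_cases h1 : i + 1 ∈ A <;> by_cases h2 : i ∈ A <;> cases h3 : c (i + 1) <;> cases h4 : c i <;>
    simp [h1, h2, Xor]

theorem exists_paritySign_hermanStep_eq (c : Fin N → Bool) (A : Finset (Fin N)) :
    ∃ u : ℝ, u ^ 2 = 1 ∧ ∀ j, paritySign (hermanStep c A) (j + 1)
      = u * if c (Fin.ofNat N j) then paritySign A j else paritySign A (j + 1) := by
  obtain ⟨z, hz⟩ : ∃ z : Fin N, z + 1 = Fin.ofNat N 0 := ⟨Fin.ofNat N 0 - 1, sub_add_cancel _ _⟩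
  refine ⟨if c z then tokenSign A z else 1, ?_, fun j => ?_⟩
  · split_ifs
    exacts [tokenSign_sq A z, one_pow 2]
  induction j with
  | zero =>
    rw [paritySign_succ, paritySign_succ, ← hz, tokenSign_hermanStep]
    simp only [paritySign, Finset.range_zero, Finset.prod_empty]
    split_ifs <;> ring
  | succ j ih =>
    have hsucc : Fin.ofNat N (j + 1) = Fin.ofNat N j + 1 := by ext; simp [Fin.val_add]
    rw [paritySign_succ, ih, paritySign_succ A (j + 1), hsucc, tokenSign_hermanStep,
      paritySign_succ A j]
    split_ifs <;> ring

theorem exists_card_eq_card_hermanStep_add (c : Fin N → Bool) (A : Finset (Fin N)) :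
    ∃ r, A.card = (hermanStep c A).card + 2 * r := by
  set kept := A.filter fun i => c i = false
  set passed := (A.filter fun i => c i = true).image fun i => i + 1
  have hA : A.card = kept.card + passed.card := by
    rw [Finset.card_image_of_injective _ (add_left_injective 1), add_comm,
      ← Finset.card_filter_add_card_filter_not (s := A) (fun i => c i = true)]
    simp [kept]
  have hstep : (hermanStep c A).card = (kept \ passed).card + (passed \ kept).card :=
    Finset.card_union_of_disjoint disjoint_sdiff_sdiff
  have hkept := Finset.card_sdiff_add_card_inter kept passed
  have hpassed := Finset.card_sdiff_add_card_inter passed kept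
  rw [Finset.inter_comm] at hpassed
  exact ⟨(kept ∩ passed).card, by omega⟩

theorem odd_card_hermanStep (c : Fin N → Bool) (hA : Odd A.card) :
    Odd (hermanStep c A).card := by
  obtain ⟨r, hr⟩ := exists_card_eq_card_hermanStep_add c A
  exact (Nat.odd_add.1 (hr ▸ hA)).2 (even_two_mul r)

theorem card_hermanStep_le (c : Fin N → Bool) (A : Finset (Fin N)) :
    (hermanStep c A).card ≤ A.card := by
  obtain ⟨r, hr⟩ := exists_card_eq_card_hermanStep_add c A
  omega

theorem windowEnergy_paritySign_hermanStep (c : Fin N → Bool) (hA : Odd A.card) :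
    windowEnergy N (paritySign (hermanStep c A))
      = windowEnergy N fun j =>
        if c (Fin.ofNat N j) then paritySign A j else paritySign A (j + 1) := by
  obtain ⟨u, hu, hstep⟩ := exists_paritySign_hermanStep_eq c A
  rw [← windowEnergy_add_right (antiperiodic_paritySign (odd_card_hermanStep c hA)) 1]
  simp only [hstep, windowEnergy_const_mul, hu, one_mul]

end Configuration

section FairCoins

open ProbabilityTheory

theorem integral_sq_sum_of_pairwise_indepFun {Ω ι : Type*} [MeasurableSpace Ω] {μ : Measure Ω}
    [IsProbabilityMeasure μ] {s : Finset ι} {X : ι → Ω → ℝ} (hX : ∀ i ∈ s, MemLp (X i) 2 μ)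
    (hindep : Set.Pairwise ↑s fun i j => IndepFun (X i) (X j) μ) :
    ∫ ω, (∑ i ∈ s, X i ω) ^ 2 ∂μ = (∑ i ∈ s, ∫ ω, X i ω ∂μ) ^ 2 + ∑ i ∈ s, Var[X i; μ] := by
  have hvar := variance_eq_sub (memLp_finsetSum' s hX)
  rw [IndepFun.variance_sum hX hindep] at hvar
  simp only [Pi.pow_apply, Finset.sum_apply,
    integral_finsetSum s fun i hi => (hX i hi).integrable one_le_two] at hvar
  linarith

theorem integral_uniformOfFintype_bool (g : Bool → ℝ) :
    ∫ b, g b ∂(PMF.uniformOfFintype Bool).toMeasure = (g true + g false) / 2 := by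
  rw [PMF.integral_eq_sum, Fintype.sum_bool]
  simp only [PMF.uniformOfFintype_apply, Fintype.card_bool, ENNReal.toReal_inv, Nat.cast_ofNat,
    ENNReal.toReal_ofNat, smul_eq_mul]
  ring

theorem variance_uniformOfFintype_bool (g : Bool → ℝ) :
    Var[g; (PMF.uniformOfFintype Bool).toMeasure] = ((g true - g false) / 2) ^ 2 := by
  rw [variance_eq_sub .of_discrete, integral_uniformOfFintype_bool, integral_uniformOfFintype_bool]
  simp only [Pi.pow_apply]
  ring

/-- The law of independent fair coins indexed by `κ`; for `κ = Fin N`, the coins of one step of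
Herman's algorithm. -/
noncomputable def fairCoins (κ : Type*) [Fintype κ] : Measure (κ → Bool) :=
  Measure.pi fun _ : κ => (PMF.uniformOfFintype Bool).toMeasure

variable {κ : Type*} [Fintype κ]

instance isProbabilityMeasure_fairCoins : IsProbabilityMeasure (fairCoins κ) := by
  unfold fairCoins; infer_instance

theorem integral_fairCoins_eval (k : κ) (g : Bool → ℝ) :
    ∫ c, g (c k) ∂fairCoins κ = (g true + g false) / 2 := by
  rw [fairCoins, integral_comp_eval (measurable_of_finite g).aestronglyMeasurable,
    integral_uniformOfFintype_bool]

theorem variance_fairCoins_eval (k : κ) (g : Bool → ℝ) :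
    Var[fun c => g (c k); fairCoins κ] = ((g true - g false) / 2) ^ 2 := by
  rw [fairCoins, (measurePreserving_eval _ k).variance_fun_comp
    (measurable_of_finite g).aemeasurable, variance_uniformOfFintype_bool]

theorem integral_sq_sum_fairCoins {ι : Type*} {s : Finset ι} {e : ι → κ} (he : Set.InjOn e s)
    (g : ι → Bool → ℝ) :
    ∫ c, (∑ i ∈ s, g i (c (e i))) ^ 2 ∂fairCoins κ
      = (∑ i ∈ s, (g i true + g i false) / 2) ^ 2
        + ∑ i ∈ s, ((g i true - g i false) / 2) ^ 2 := by
  have hcoins : iIndepFun (fun k (c : κ → Bool) => c k) (fairCoins κ) :=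
    iIndepFun_pi (X := fun _ b => b) fun _ => aemeasurable_id
  have hindep : Set.Pairwise ↑s fun i j =>
      IndepFun (fun c => g i (c (e i))) (fun c => g j (c (e j))) (fairCoins κ) :=
    fun i hi j hj hij => (hcoins.indepFun (he.ne hi hj hij)).comp
      (measurable_of_finite (g i)) (measurable_of_finite (g j))
  rw [integral_sq_sum_of_pairwise_indepFun (fun i _ => .of_discrete) hindep]
  simp only [integral_fairCoins_eval, variance_fairCoins_eval]

theorem integral_windowEnergy_ite {N : ℕ} [NeZero N] (s : ℕ → ℝ) :
    ∫ c, windowEnergy N (fun j => if c (Fin.ofNat N j) then s j else s (j + 1)) ∂fairCoins (Fin N)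
      = ∑ j ∈ Finset.range N, (((windowSum N s j + windowSum N s (j + 1)) / 2) ^ 2
        + ∑ d ∈ Finset.range N, ((s (j + d) - s (j + d + 1)) / 2) ^ 2) := by
  simp only [windowEnergy, windowSum]
  rw [integral_finsetSum _ fun _ _ => .of_finite]
  refine Finset.sum_congr rfl fun j _ => ?_
  rw [integral_sq_sum_fairCoins (injOn_ofNat_add j)
    fun d b => if b then s (j + d) else s (j + d + 1)]
  simp only [if_true, Bool.false_eq_true, if_false, ← Finset.sum_div, Finset.sum_add_distrib,
    add_right_comm]

theorem integral_windowEnergy_paritySign_hermanStep {N : ℕ} [NeZero N] {A : Finset (Fin N)}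
    (hA : Odd A.card) :
    ∫ c, windowEnergy N (paritySign (hermanStep c A)) ∂fairCoins (Fin N)
      = windowEnergy N (paritySign A) + N * (A.card - 1) := by
  have hspread (j : ℕ) : ∑ d ∈ Finset.range N,
      ((paritySign A (j + d) - paritySign A (j + d + 1)) / 2) ^ 2 = (A.card : ℝ) := by
    simp only [div_pow, ← Finset.sum_div, sub_sq_comm (paritySign A (j + _)) _,
      sum_paritySign_succ_sub_sq]
    ring
  simp only [windowEnergy_paritySign_hermanStep _ hA, integral_windowEnergy_ite, hspread,
    Finset.sum_add_distrib, sum_sq_mean_windowSum (antiperiodic_paritySign hA) (paritySign_sq A),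
    Finset.sum_const, Finset.card_range, nsmul_eq_mul]
  ring

end FairCoins

section LevelPotential

/-- An upper bound for the mean time to get from level `k` to level `0`, when the level never rises
and a quantity, with current value `v` and at most `B i` at each level `i`, loses `i` in the mean in
each step from level `i`: the time to fall from `B k` to `B 0` at speed `i + 1` between `B (i + 1)`
and `B i`, less the time saved by starting at `v` instead of `B k`. For `k = 0` the division by zero
makes it `0`. -/
noncomputable def levelPotential (B : ℕ → ℝ) (k : ℕ) (v : ℝ) : ℝ :=
  ∑ i ∈ Finset.range k, (B (i + 1) - B i) / (i + 1) - (B k - v) / k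

variable {B : ℕ → ℝ} {k : ℕ} {v : ℝ}

theorem levelPotential_zero : levelPotential B 0 v = 0 := by
  simp [levelPotential]

theorem levelPotential_sub_natCast (hk : k ≠ 0) :
    levelPotential B k (v - k) = levelPotential B k v - 1 := by
  have hk' : (k : ℝ) ≠ 0 := Nat.cast_ne_zero.2 hk
  unfold levelPotential
  field_simp
  ring

theorem levelPotential_le_sum (hv : v ≤ B k) :
    levelPotential B k v ≤ ∑ i ∈ Finset.range k, (B (i + 1) - B i) / (i + 1) :=
  sub_le_self _ (div_nonneg (sub_nonneg.2 hv) k.cast_nonneg)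

theorem levelPotential_le_succ (hv : v ≤ B k) (hv0 : k = 0 → B 0 ≤ v) :
    levelPotential B k v ≤ levelPotential B (k + 1) v := by
  unfold levelPotential
  rw [Finset.sum_range_succ]
  rcases Nat.eq_zero_or_pos k with rfl | hk
  · simpa using hv0 rfl
  · have hk' : (0 : ℝ) < k := Nat.cast_pos.2 hk
    have hgain : (B k - v) / (k + 1) ≤ (B k - v) / k :=
      div_le_div_of_nonneg_left (sub_nonneg.2 hv) hk' (by linarith)
    have hsplit : (B (k + 1) - v) / (k + 1)
        = (B (k + 1) - B k) / (k + 1) + (B k - v) / (k + 1) := by ring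
    push_cast
    linarith

theorem integral_levelPotential {Ω : Type*} [MeasurableSpace Ω] {μ : Measure Ω}
    [IsProbabilityMeasure μ] {f : Ω → ℝ} (hf : Integrable f μ) :
    ∫ ω, levelPotential B k (f ω) ∂μ = levelPotential B k (∫ ω, f ω ∂μ) := by
  have hquotient : Integrable (fun ω => (B k - f ω) / k) μ :=
    ((integrable_const _).sub hf).div_const _
  simp only [levelPotential, integral_sub (integrable_const _) hquotient, integral_div,
    integral_sub (integrable_const _) hf, integral_const, probReal_univ, one_smul]

end LevelPotential

theorem hasSum_one_div_odd_sq :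
    HasSum (fun n : ℕ => 1 / (2 * n + 1 : ℝ) ^ 2) (Real.pi ^ 2 / 8) := by
  have heven : HasSum (fun n : ℕ => 1 / ((2 * n : ℕ) : ℝ) ^ 2) (1 / 4 * (Real.pi ^ 2 / 6)) := by
    convert! hasSum_zeta_two.mul_left (1 / 4) using 2 with n
    push_cast
    ring
  have hodd : Summable fun n : ℕ => 1 / ((2 * n + 1 : ℕ) : ℝ) ^ 2 :=
    hasSum_zeta_two.summable.comp_injective (i := fun n : ℕ => 2 * n + 1) fun m n h => by
      simpa using h
  have htotal := (heven.even_add_odd (f := fun n : ℕ => 1 / (n : ℝ) ^ 2) hodd.hasSum).unique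
    hasSum_zeta_two
  convert hodd.hasSum using 1
  · push_cast
    rfl
  · linarith

theorem hasSum_one_div_odd_sub_one_div_odd :
    HasSum (fun n : ℕ => 1 / (2 * n + 1 : ℝ) - 1 / (2 * n + 3)) 1 := by
  have hnonneg (n : ℕ) : (0 : ℝ) ≤ 1 / (2 * n + 1) - 1 / (2 * n + 3) :=
    sub_nonneg.2 (one_div_le_one_div_of_le (by positivity) (by linarith))
  have hpartial (n : ℕ) :
      ∑ i ∈ Finset.range n, (1 / (2 * i + 1 : ℝ) - 1 / (2 * i + 3)) = 1 - 1 / (2 * n + 1) := by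
    induction n with
    | zero => simp
    | succ n ih =>
      rw [Finset.sum_range_succ, ih, Nat.cast_add_one]
      ring
  have hodd : Filter.Tendsto (fun n : ℕ => (2 * n + 1 : ℝ)) Filter.atTop Filter.atTop :=
    Filter.tendsto_atTop_add_const_right _ _
      (tendsto_natCast_atTop_atTop.const_mul_atTop two_pos)
  rw [hasSum_iff_tendsto_nat_of_nonneg hnonneg]
  simpa only [hpartial, sub_zero] using (hodd.const_div_atTop 1).const_sub 1

theorem hasSum_one_div_odd_mul_odd_sq :
    HasSum (fun n : ℕ => 1 / ((2 * n + 1 : ℝ) ^ 2 * (2 * n + 3) ^ 2)) ((Real.pi ^ 2 - 8) / 16) := by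
  have hshift : HasSum (fun n : ℕ => 1 / (2 * n + 3 : ℝ) ^ 2) (Real.pi ^ 2 / 8 - 1) := by
    convert! (hasSum_nat_add_iff' 1).2 hasSum_one_div_odd_sq using 2 with n
    · rw [Nat.cast_add_one]
      ring
    · simp
  have hfractions (n : ℕ) : 1 / ((2 * n + 1 : ℝ) ^ 2 * (2 * n + 3) ^ 2)
      = (1 / (2 * n + 1 : ℝ) ^ 2 + 1 / (2 * n + 3) ^ 2
        - (1 / (2 * n + 1) - 1 / (2 * n + 3))) / 4 := by
    field_simp
    ring
  simp only [hfractions]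
  convert! ((hasSum_one_div_odd_sq.add hshift).sub hasSum_one_div_odd_sub_one_div_odd).div_const 4
    using 1
  ring

section TimePotential

variable {N : ℕ} [NeZero N] {A : Finset (Fin N)} {k : ℕ}

/-- The amount, divided by `2 * N`, by which the window energy of `A` falls short of the one of a
single token, normalised so that a step lowers its mean by half of the number of excess tokens. -/
noncomputable def energyDeficit (A : Finset (Fin N)) : ℝ :=
  (N ^ 2 + 2) / 6 - windowEnergy N (paritySign A) / (2 * N)

/-- The value of `energyDeficit` for `2 * k + 1` equally spaced tokens on a continuous ring, an
upper bound for its values at `2 * k + 1` tokens. -/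
noncomputable def deficitBound (N k : ℕ) : ℝ := N ^ 2 / 6 * (1 - 1 / (2 * k + 1) ^ 2)

theorem monotone_deficitBound (N : ℕ) : Monotone (deficitBound N) := fun i j hij => by
  unfold deficitBound
  gcongr

theorem deficitBound_zero (N : ℕ) : deficitBound N 0 = 0 := by
  simp [deficitBound]

theorem energyDeficit_of_card_eq_one (hA : A.card = 1) : energyDeficit A = 0 := by
  have hN : (N : ℝ) ≠ 0 := Nat.cast_ne_zero.2 (NeZero.ne N)
  rw [energyDeficit, windowEnergy_paritySign_of_card_eq_one hA]
  field_simp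
  ring

theorem energyDeficit_le (hA : A.card = 2 * k + 1) : energyDeficit A ≤ deficitBound N k := by
  have hN : (0 : ℝ) < N := Nat.cast_pos.2 (NeZero.pos N)
  set m : ℝ := 2 * k + 1 with hm
  have hm0 : 0 < m := by positivity
  have henergy : N * ((N / m) ^ 2 + 2 / 3) - (N / m) ^ 3 / 3 * (2 * m)
      ≤ windowEnergy N (paritySign A) := by
    have := le_windowEnergy (a := N / m) (by positivity) (antiperiodic_paritySign ⟨k, hA⟩)
      (paritySign_sq A)
    rwa [sum_abs_paritySign_succ_sub, hA, Nat.cast_succ, Nat.cast_mul, Nat.cast_two] at this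
  calc energyDeficit A
      ≤ (N ^ 2 + 2) / 6 - (N * ((N / m) ^ 2 + 2 / 3) - (N / m) ^ 3 / 3 * (2 * m)) / (2 * N) := by
        unfold energyDeficit; gcongr
    _ = deficitBound N k := by
        rw [deficitBound, ← hm]; field_simp; ring

theorem integral_energyDeficit_hermanStep (hA : A.card = 2 * k + 1) :
    ∫ c, energyDeficit (hermanStep c A) ∂fairCoins (Fin N) = energyDeficit A - k := by
  have hN : (N : ℝ) ≠ 0 := Nat.cast_ne_zero.2 (NeZero.ne N)
  simp only [energyDeficit]
  rw [integral_sub .of_finite .of_finite, integral_const, integral_div (2 * (N : ℝ)),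
    integral_windowEnergy_paritySign_hermanStep ⟨k, hA⟩, hA, probReal_univ, one_smul]
  push_cast
  field_simp
  ring

/-- A bound for the mean time to stabilisation from `A`, where `2 * k + 1` tokens are level `k`. -/
noncomputable def timePotential (A : Finset (Fin N)) : ℝ :=
  levelPotential (deficitBound N) (A.card / 2) (energyDeficit A)

theorem timePotential_of_card (hA : A.card = 2 * k + 1) :
    timePotential A = levelPotential (deficitBound N) k (energyDeficit A) := by
  rw [timePotential, show A.card / 2 = k by omega]

theorem timePotential_of_card_eq_one (hA : A.card = 1) : timePotential A = 0 := by
  rw [timePotential_of_card (k := 0) hA, levelPotential_zero]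

theorem timePotential_le_levelPotential (hA : Odd A.card) (hk : A.card ≤ 2 * k + 1) :
    timePotential A ≤ levelPotential (deficitBound N) k (energyDeficit A) := by
  obtain ⟨l, hl⟩ := hA
  have hlk : l ≤ k := by omega
  rw [timePotential_of_card hl]
  induction k, hlk using Nat.le_induction with
  | base => exact le_rfl
  | succ j hlj ih =>
    refine (ih (by omega)).trans (levelPotential_le_succ ?_ fun hj => ?_)
    · exact (energyDeficit_le hl).trans (monotone_deficitBound N hlj)
    · rw [deficitBound_zero, energyDeficit_of_card_eq_one (by omega)]

theorem integral_timePotential_hermanStep_le (hA : Odd A.card) (hA1 : A.card ≠ 1) :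
    ∫ c, timePotential (hermanStep c A) ∂fairCoins (Fin N) ≤ timePotential A - 1 := by
  obtain ⟨k, hk⟩ := hA
  calc ∫ c, timePotential (hermanStep c A) ∂fairCoins (Fin N)
      ≤ ∫ c, levelPotential (deficitBound N) k (energyDeficit (hermanStep c A))
          ∂fairCoins (Fin N) :=
        integral_mono .of_finite .of_finite fun c => timePotential_le_levelPotential
          (odd_card_hermanStep c ⟨k, hk⟩) (hk ▸ card_hermanStep_le c A)
    _ = timePotential A - 1 := by
        rw [integral_levelPotential .of_finite, integral_energyDeficit_hermanStep hk,
          levelPotential_sub_natCast (by omega), timePotential_of_card hk]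

theorem sum_deficitBound_succ_sub_div_lt (N k : ℕ) [NeZero N] :
    ∑ i ∈ Finset.range k, (deficitBound N (i + 1) - deficitBound N i) / (i + 1)
      < (Real.pi ^ 2 - 8) * N ^ 2 / 12 := by
  have hN : (0 : ℝ) < N := Nat.cast_pos.2 (NeZero.pos N)
  have hterm (i : ℕ) : (deficitBound N (i + 1) - deficitBound N i) / (i + 1)
      = 4 * N ^ 2 / 3 * (1 / ((2 * i + 1 : ℝ) ^ 2 * (2 * i + 3) ^ 2)) := by
    have hodd : 2 * ((i : ℝ) + 1) + 1 = 2 * i + 3 := by ring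
    simp only [deficitBound, Nat.cast_add_one, hodd]
    field_simp
    ring
  simp only [hterm, ← Finset.mul_sum]
  calc 4 * N ^ 2 / 3 * ∑ i ∈ Finset.range k, 1 / ((2 * i + 1 : ℝ) ^ 2 * (2 * i + 3) ^ 2)
      < 4 * N ^ 2 / 3 * ((Real.pi ^ 2 - 8) / 16) := by
        have hpos (i : ℕ) : (0 : ℝ) < 1 / ((2 * i + 1 : ℝ) ^ 2 * (2 * i + 3) ^ 2) := by positivity
        gcongr
        refine lt_of_lt_of_le ?_ (sum_le_hasSum (Finset.range (k + 1)) (fun i _ => (hpos i).le)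
          hasSum_one_div_odd_mul_odd_sq)
        rw [Finset.sum_range_succ]
        exact lt_add_of_pos_right _ (hpos k)
    _ = (Real.pi ^ 2 - 8) * N ^ 2 / 12 := by ring

theorem timePotential_lt (hA : Odd A.card) :
    timePotential A < (Real.pi ^ 2 - 8) * N ^ 2 / 12 := by
  obtain ⟨k, hk⟩ := hA
  rw [timePotential_of_card hk]
  exact (levelPotential_le_sum (energyDeficit_le hk)).trans_lt
    (sum_deficitBound_succ_sub_div_lt N k)

end TimePotential

section Drift

open ProbabilityTheory

variable {Ω α : Type*} {step : Ω → α → α} {G S : Set α} {x : α}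

/-- The orbit of `x` when the map applied at time `t` is `step (ω t)`. -/
def randomOrbit (step : Ω → α → α) (x : α) (ω : ℕ → Ω) : ℕ → α
  | 0 => x
  | t + 1 => step (ω t) (randomOrbit step x ω t)

/-- The first time at which the random orbit of `x` is in `G`, and `⊤` if it never is. -/
noncomputable def entryTime (step : Ω → α → α) (G : Set α) (x : α) (ω : ℕ → Ω) : ℕ∞ :=
  ⨅ (t : ℕ) (_ : randomOrbit step x ω t ∈ G), (t : ℕ∞)

theorem randomOrbit_succ (ω : ℕ → Ω) (t : ℕ) :
    randomOrbit step x ω (t + 1) = randomOrbit step (step (ω 0) x) (fun t => ω (t + 1)) t := by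
  induction t with
  | zero => rfl
  | succ t ih => rw [randomOrbit, ih, randomOrbit]

theorem entryTime_of_mem (hx : x ∈ G) (ω : ℕ → Ω) : entryTime step G x ω = 0 :=
  nonpos_iff_eq_zero.1 (iInf₂_le 0 hx)

theorem entryTime_of_notMem (hx : x ∉ G) (ω : ℕ → Ω) :
    entryTime step G x ω = entryTime step G (step (ω 0) x) (fun t => ω (t + 1)) + 1 := by
  rw [entryTime, ← inf_iInf_nat_succ]
  simp only [randomOrbit_succ, entryTime, ENat.iInf_add, Nat.cast_add_one]
  rw [iInf_neg (show randomOrbit step x ω 0 ∉ G from hx), top_inf_eq]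

variable [MeasurableSpace Ω] {ν : Measure Ω} [IsProbabilityMeasure ν]

theorem nonneg_of_integral_lt {V : α → ℝ} (hfin : S.Finite) (hS : ∀ y ∈ S \ G, ∀ c, step c y ∈ S)
    (hVG : ∀ y ∈ S ∩ G, 0 ≤ V y) (hVint : ∀ y ∈ S \ G, Integrable (fun c => V (step c y)) ν)
    (hV : ∀ y ∈ S \ G, ∫ c, V (step c y) ∂ν < V y) (hx : x ∈ S) : 0 ≤ V x := by
  obtain ⟨y, hyS, hmin⟩ := Set.exists_min_image S V hfin ⟨x, hx⟩
  suffices hyG : y ∈ G from (hVG y ⟨hyS, hyG⟩).trans (hmin x hx)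
  by_contra hyG
  have hle : V y ≤ ∫ c, V (step c y) ∂ν := by
    simpa using integral_mono (integrable_const (V y)) (hVint y ⟨hyS, hyG⟩) fun c =>
      hmin _ (hS y ⟨hyS, hyG⟩ c)
  exact (hV y ⟨hyS, hyG⟩).not_ge hle

theorem map_head_tail_infinitePi (ν : Measure Ω) [IsProbabilityMeasure ν] :
    (Measure.infinitePi fun _ : ℕ => ν).map (fun ω => (ω 0, fun t => ω (t + 1)))
      = ν.prod (Measure.infinitePi fun _ : ℕ => ν) := by
  have hhead : Measurable fun ω : ℕ → Ω => ω 0 := measurable_pi_apply 0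
  have htail : Measurable fun (ω : ℕ → Ω) t => ω (t + 1) := by fun_prop
  have hindep : IndepFun (fun ω : ℕ → Ω => ω 0) (fun ω t => ω (t + 1))
      (Measure.infinitePi fun _ => ν) := by
    have hcoord : iIndepFun (fun t (ω : ℕ → Ω) => ω t) (Measure.infinitePi fun _ => ν) :=
      iIndepFun_infinitePi (X := fun _ => id) fun _ => measurable_id
    refine indep_of_indep_of_le_left (indep_of_indep_of_le_right
      (indep_iSup_of_disjoint (fun t => (measurable_pi_apply t).comap_le) hcoord
        (S := {0}) (T := {0}ᶜ) disjoint_compl_right) ?_) ?_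
    · rw [MeasurableSpace.pi, MeasurableSpace.comap_iSup]
      refine iSup_le fun t => ?_
      rw [MeasurableSpace.comap_comp]
      exact le_iSup₂_of_le (t + 1) (by simp) le_rfl
    · exact le_iSup₂_of_le 0 rfl le_rfl
  rw [hindep.map_prod_eq_prod_map_map hhead.aemeasurable htail.aemeasurable,
    Measure.infinitePi_map_eval, Measure.map_infinitePi_infinitePi_of_inj Nat.succ_injective]

variable [MeasurableSpace α]

theorem measurable_randomOrbit (hstep : Measurable (Function.uncurry step)) (t : ℕ) :
    Measurable fun p : α × (ℕ → Ω) => randomOrbit step p.1 p.2 t := by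
  induction t with
  | zero => exact measurable_fst
  | succ t ih => exact hstep.comp (((measurable_pi_apply t).comp measurable_snd).prodMk ih)

theorem measurable_toENNReal_entryTime (hstep : Measurable (Function.uncurry step))
    (hG : MeasurableSet G) :
    Measurable fun p : α × (ℕ → Ω) => (entryTime step G p.1 p.2 : ℝ≥0∞) := by
  classical
  simp only [entryTime, ENat.toENNReal_iInf]
  simp only [iInf_eq_if]
  exact .iInf fun t => .ite (measurable_randomOrbit hstep t hG) measurable_const measurable_const

theorem lintegral_min_entryTime_le {V : α → ℝ≥0∞} (hstep : Measurable (Function.uncurry step))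
    (hG : MeasurableSet G) (hS : ∀ y ∈ S \ G, ∀ c, step c y ∈ S)
    (hV : ∀ y ∈ S \ G, ∫⁻ c, V (step c y) ∂ν + 1 ≤ V y) (hx : x ∈ S) (n : ℕ) :
    ∫⁻ ω, min (entryTime step G x ω : ℝ≥0∞) n ∂Measure.infinitePi (fun _ : ℕ => ν) ≤ V x := by
  induction n generalizing x with
  | zero => simp
  | succ n ih =>
    by_cases hxG : x ∈ G
    · simp [entryTime_of_mem hxG]
    have hstep_x : Measurable fun c => step c x :=
      hstep.comp (measurable_id.prodMk measurable_const)
    have hmeas : Measurable fun p : Ω × (ℕ → Ω) =>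
        min (entryTime step G (step p.1 x) p.2 : ℝ≥0∞) n + 1 :=
      (((measurable_toENNReal_entryTime hstep hG).comp
        ((hstep_x.comp measurable_fst).prodMk measurable_snd)).min measurable_const).add_const 1
    have hfirst (ω : ℕ → Ω) : min (entryTime step G x ω : ℝ≥0∞) (n + 1 : ℕ)
        = min (entryTime step G (step (ω 0) x) (fun t => ω (t + 1)) : ℝ≥0∞) n + 1 := by
      rw [entryTime_of_notMem hxG, ENat.toENNReal_add, ENat.toENNReal_one, Nat.cast_add_one,
        min_add_add_right]
    calc ∫⁻ ω, min (entryTime step G x ω : ℝ≥0∞) (n + 1 : ℕ) ∂Measure.infinitePi (fun _ : ℕ => ν)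
        = ∫⁻ p, (min (entryTime step G (step p.1 x) p.2 : ℝ≥0∞) n + 1)
            ∂ν.prod (Measure.infinitePi fun _ : ℕ => ν) := by
          simp only [hfirst]
          rw [← map_head_tail_infinitePi, lintegral_map hmeas (by fun_prop)]
      _ = ∫⁻ c, (∫⁻ ω, min (entryTime step G (step c x) ω : ℝ≥0∞) n
            ∂Measure.infinitePi (fun _ : ℕ => ν)) + 1 ∂ν := by
          rw [lintegral_prod _ hmeas.aemeasurable]
          simp only [lintegral_add_right _ measurable_const, lintegral_one, measure_univ]
      _ ≤ ∫⁻ c, V (step c x) + 1 ∂ν := lintegral_mono fun c => by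
          gcongr
          exact ih (hS x ⟨hx, hxG⟩ c)
      _ = ∫⁻ c, V (step c x) ∂ν + 1 := by
          rw [lintegral_add_right _ measurable_const, lintegral_one, measure_univ]
      _ ≤ V x := hV x ⟨hx, hxG⟩

theorem lintegral_entryTime_le {V : α → ℝ≥0∞} (hstep : Measurable (Function.uncurry step))
    (hG : MeasurableSet G) (hS : ∀ y ∈ S \ G, ∀ c, step c y ∈ S)
    (hV : ∀ y ∈ S \ G, ∫⁻ c, V (step c y) ∂ν + 1 ≤ V y) (hx : x ∈ S) :
    ∫⁻ ω, (entryTime step G x ω : ℝ≥0∞) ∂Measure.infinitePi (fun _ : ℕ => ν) ≤ V x := by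
  have hmeas : Measurable fun ω : ℕ → Ω => (entryTime step G x ω : ℝ≥0∞) :=
    Measurable.of_uncurry_left (f := fun y ω => (entryTime step G y ω : ℝ≥0∞))
      (measurable_toENNReal_entryTime hstep hG)
  calc ∫⁻ ω, (entryTime step G x ω : ℝ≥0∞) ∂Measure.infinitePi (fun _ : ℕ => ν)
      = ∫⁻ ω, ⨆ n : ℕ, min (entryTime step G x ω : ℝ≥0∞) n
          ∂Measure.infinitePi (fun _ : ℕ => ν) := by
        simp only [← inf_iSup_eq, ENNReal.iSup_natCast, inf_top_eq]
    _ = ⨆ n : ℕ, ∫⁻ ω, min (entryTime step G x ω : ℝ≥0∞) n ∂Measure.infinitePi (fun _ : ℕ => ν) :=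
        lintegral_iSup (fun n => hmeas.min measurable_const) fun m n hmn ω => by
          dsimp only
          gcongr
    _ ≤ V x := iSup_le (lintegral_min_entryTime_le hstep hG hS hV hx)

theorem lintegral_entryTime_le_ofReal {V : α → ℝ} (hstep : Measurable (Function.uncurry step))
    (hG : MeasurableSet G) (hfin : S.Finite) (hS : ∀ y ∈ S \ G, ∀ c, step c y ∈ S)
    (hVG : ∀ y ∈ S ∩ G, 0 ≤ V y) (hVint : ∀ y ∈ S \ G, Integrable (fun c => V (step c y)) ν)
    (hV : ∀ y ∈ S \ G, ∫ c, V (step c y) ∂ν ≤ V y - 1) (hx : x ∈ S) :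
    ∫⁻ ω, (entryTime step G x ω : ℝ≥0∞) ∂Measure.infinitePi (fun _ : ℕ => ν)
      ≤ ENNReal.ofReal (V x) := by
  have hnonneg : ∀ y ∈ S, 0 ≤ V y := fun y =>
    nonneg_of_integral_lt hfin hS hVG hVint fun z hz => (hV z hz).trans_lt (sub_one_lt _)
  refine lintegral_entryTime_le (V := fun y => ENNReal.ofReal (V y)) hstep hG hS
    (fun y hy => ?_) hx
  have hmean : ∀ c, 0 ≤ V (step c y) := fun c => hnonneg _ (hS y hy c)
  rw [← ofReal_integral_eq_lintegral_ofReal (hVint y hy) (.of_forall hmean), ← ENNReal.ofReal_one,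
    ← ENNReal.ofReal_add (integral_nonneg hmean) zero_le_one]
  exact ENNReal.ofReal_le_ofReal (le_sub_iff_add_le.1 (hV y hy))

end Drift

theorem hermanRun_eq_randomOrbit {N : ℕ} [NeZero N] (A : Finset (Fin N)) (ω : ℕ → Fin N → Bool)
    (t : ℕ) : hermanRun A ω t = randomOrbit hermanStep A ω t := by
  induction t with
  | zero => rfl
  | succ t ih => rw [hermanRun, ih, randomOrbit]

theorem stabilisationTime_eq_entryTime {N : ℕ} [NeZero N] (A : Finset (Fin N))
    (ω : ℕ → Fin N → Bool) :
    stabilisationTime A ω = entryTime hermanStep {B | B.card = 1} A ω := by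
  simp only [stabilisationTime, entryTime, hermanRun_eq_randomOrbit, Set.mem_ofPred_eq]

theorem expectedStabilisationTime_le {N : ℕ} [NeZero N] {A : Finset (Fin N)} (hA : Odd A.card) :
    expectedStabilisationTime A ≤ ENNReal.ofReal (timePotential A) := by
  simp only [expectedStabilisationTime, stabilisationTime_eq_entryTime]
  exact lintegral_entryTime_le_ofReal (ν := fairCoins (Fin N))
    (S := {B : Finset (Fin N) | Odd B.card})
    (measurable_of_finite _) (Set.toFinite _).measurableSet (Set.toFinite _)
    (fun _ hB c => odd_card_hermanStep c hB.1) (fun _ hB => (timePotential_of_card_eq_one hB.2).ge)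
    (fun _ _ => .of_finite) (fun _ hB => integral_timePotential_hermanStep_le hB.1 hB.2) hA

theorem mainTheorem1 (N : ℕ) [NeZero N] (A : Finset (Fin N)) (hA : Odd A.card) :
    expectedStabilisationTime A < ENNReal.ofReal ((Real.pi ^ 2 - 8) * (N : ℝ) ^ 2 / 12) := by
  have hbound : 0 < (Real.pi ^ 2 - 8) * (N : ℝ) ^ 2 / 12 := by
    have hpi : 0 < Real.pi ^ 2 - 8 := by nlinarith [Real.pi_gt_three]
    have hN : (0 : ℝ) < N := Nat.cast_pos.2 (NeZero.pos N)
    positivity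
  exact (expectedStabilisationTime_le hA).trans_lt
    ((ENNReal.ofReal_lt_ofReal_iff hbound).2 (timePotential_lt hA))
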